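/- Let $A$ be a countable alphabet with the discrete topology. A past is a sequence $x=(\dots,x_{-2},x_{-1})\in\mathcal X^-:=A^{\{\dots,-2,-1\}}$, and a (shift-invariant) probability kernel is a function $g:A\times\mathcal X^-\to[0,1]$ such that $\sum_{a\in A}g(a|x)=1$ for every $x\in\mathcal X^-$. For $j\ge1$ let $$\mathrm{Osc}_j(g)=\sup\Big\{\tfrac12\sum_{a\in A}|g(a|z)-g(a|z')| : z,z'\in\mathcal X^-,\ z_k=z'_k\ \text{for all } k\ne -j\Big\},\qquad \Delta(g)=1-\sum_{j\ge1}\mathrm{Osc}_j(g)\in[-\infty,1].$$ For $x\in\mathcal X^-$, let $P^x$ be the law on $A^{\mathbb N}$ of the chain specified by $g$ and started from the past $x$, i.e. the probability measure with $$P^x(\omega_0=\sigma_0,\dots,\omega_n=\sigma_n)=\prod_{j=0}^n g(\sigma_j\,|\,x\sigma_0\cdots\sigma_{j-1})$$ for all $n\ge0$ and $\sigma_0,\dots,\sigma_n\in A$, where $x\sigma_0\cdots\sigma_{j-1}$ denotes concatenation. For $f:A^{n+1}\to\mathbb R$ and $0\le j\le n$, let $\delta_j(f)$ be the supremum of $|f(\omega)-f(\omega')|$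 over $\omega,\omega'\in A^{n+1}$ that differ at most in the coordinate $j$. Let $\mathcal L$ be the set of all such $f$, for all $n\ge0$, with $\delta_j(f)<\infty$ for $j=0,\dots,n$, put $\|\delta(f)\|_2^2=\sum_{j=0}^n\delta_j(f)^2$, and regard $f$ as the function $\omega\mapsto f(\omega_0,\dots,\omega_n)$ on $A^{\mathbb N}$. **Theorem.** Let $g$ be a probability kernel with $\Delta(g)>0$. Then every $f\in\mathcal L$ is $P^x$-integrable for every $x\in\mathcal X^-$, and for all $\theta\in\mathbb R$ $$\sup_{x\in\mathcal X^-}\mathbb E_{P^x}\Big[e^{\theta(f-\mathbb E_{P^x}[f])}\Big]\le\exp\Big(\frac{\theta^2\Delta(g)^{-2}}{8}\,\|\delta(f)\|_2^2\Big).$$ Moreover, for all $u>0$, $$\sup_{x\in\mathcal X^-}P^x\big(|f-\mathbb E_{P^x}[f]|>u\big)\le2\exp\Big(-\frac{2u^2}{\Delta(g)^{-2}\|\delta(f)\|_2^2}\Big),$$ where the right-hand side is read as $0$ if $\|\delta(f)\|_2=0$. -/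

import Mathlib

open MeasureTheory ProbabilityTheory
open scoped ENNReal

namespace SCUM

/-- A shift-invariant probability kernel `g : A × A^{⟦-∞,-1⟧} → [0,1]`, `∑ a, g(a|x) = 1`, with
`g(a|x)` written `g x a`. A past `x ∈ A^{⟦-∞,-1⟧}` is encoded as `x : ℕ → A`, where `x k` is the
symbol at time `-(k+1)`. No regularity in the past is required. -/
abbrev ProbKernel (A : Type*) := (ℕ → A) → PMF A

/-- The oscillation of order `j ≥ 1`: the supremum of `(1/2) ∑ a, |g(a|z) - g(a|z')|` over pasts
`z, z'` that agree at every time `≠ -j` (time `-(k+1)` is the index `k`). -/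
noncomputable def osc {A : Type*} (g : ProbKernel A) (j : ℕ) : ℝ≥0∞ :=
  ⨆ (z : ℕ → A) (z' : ℕ → A) (_ : ∀ k, k + 1 ≠ j → z k = z' k),
    (1 / 2) * ∑' a, ENNReal.ofReal |(g z a).toReal - (g z' a).toReal|

/-- `Δ(g) = 1 - ∑_{j ≥ 1} Osc_j(g)`, which is `-∞` when the series diverges. -/
noncomputable def delta {A : Type*} (g : ProbKernel A) : EReal :=
  1 - ((∑' j : ℕ, osc g (j + 1) : ℝ≥0∞) : EReal)

/-- The past `xσ` obtained by appending the string `σ_0, …, σ_{n-1}` to the past `x`; it is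
re-indexed so that its last symbol (`σ_{n-1}`, or `x 0` if `n = 0`) has index `0`. -/
def concat {A : Type*} (x : ℕ → A) (n : ℕ) (σ : Fin n → A) : ℕ → A := fun k =>
  if h : k < n then σ ⟨n - 1 - k, by omega⟩ else x (k - n)

variable {A : Type*} [Countable A] [MeasurableSpace A] [DiscreteMeasurableSpace A]

/-- The law of the symbol at time `n + 1` given the past `x` and the symbols at times `0, …, n`. -/
noncomputable def stepKernel (g : ProbKernel A) (x : ℕ → A) (n : ℕ) :
    Kernel (Π _ : Finset.Iic n, A) A :=
  Kernel.ofFunOfCountable fun σ =>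
    (g (concat x (n + 1) fun i => σ ⟨i, Finset.mem_Iic.2 (Nat.lt_succ_iff.1 i.2)⟩)).toMeasure

instance (g : ProbKernel A) (x : ℕ → A) (n : ℕ) : IsMarkovKernel (stepKernel g x n) :=
  ⟨fun _ => inferInstanceAs (IsProbabilityMeasure (PMF.toMeasure _))⟩

/-- The law `P^x` on `A^ℕ` of the chain specified by `g` and started from the past `x`. -/
noncomputable def chainMeasure (g : ProbKernel A) (x : ℕ → A) : Measure (ℕ → A) :=
  Kernel.trajMeasure (X := fun _ => A) (g x).toMeasure (stepKernel g x)

instance (g : ProbKernel A) (x : ℕ → A) : IsProbabilityMeasure (chainMeasure g x) := by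
  unfold chainMeasure; infer_instance

/-- The defining product formula of `P^x` on cylinders. -/
theorem chainMeasure_cylinder (g : ProbKernel A) (x η : ℕ → A) (n : ℕ) :
    chainMeasure g x {ω | ∀ i ≤ n, ω i = η i} =
      ∏ j ∈ Finset.range (n + 1), g (concat x j fun i => η i) (η j) := by
  induction n with
  | zero =>
    have h0 : {ω : ℕ → A | ∀ i ≤ 0, ω i = η i} =
        (Preorder.frestrictLe (π := fun _ : ℕ => A) 0) ⁻¹'
          ((MeasurableEquiv.piUnique (fun _ : Finset.Iic 0 => A)) ⁻¹' {η 0}) := by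
      ext ω
      simp only [nonpos_iff_eq_zero, forall_eq]
      rfl
    have hc : concat x 0 (fun i : Fin 0 => η i) = x := by
      ext k
      simp [concat]
    rw [h0, chainMeasure, Kernel.trajMeasure, ← Measure.map_apply (by fun_prop)
      ((MeasurableEquiv.measurable _) (measurableSet_singleton _)),
      Measure.map_comp _ _ (by fun_prop), Kernel.traj_map_frestrictLe,
      Kernel.partialTraj_self, Measure.id_comp, Measure.map_apply (MeasurableEquiv.measurable _)
      ((MeasurableEquiv.measurable _) (measurableSet_singleton _)), ← Set.preimage_comp]
    simp only [MeasurableEquiv.self_comp_symm, Set.preimage_id]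
    rw [PMF.toMeasure_apply_singleton _ _ (measurableSet_singleton _)]
    simp [hc]
  | succ n ih =>
    have key := Kernel.map_frestrictLe_trajMeasure_compProd_eq_map_trajMeasure
      (X := fun _ => A) (μ₀ := (g x).toMeasure) (κ := stepKernel g x) (a := n)
    have key2 := DFunLike.congr_fun key ({fun i : Finset.Iic n => η i} ×ˢ {η (n + 1)})
    rw [Measure.compProd_apply_prod (measurableSet_singleton _) (measurableSet_singleton _),
      Measure.restrict_singleton, lintegral_smul_measure, lintegral_dirac,
      Measure.map_apply (by fun_prop) (measurableSet_singleton _),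
      Measure.map_apply (by fun_prop)
        ((measurableSet_singleton _).prod (measurableSet_singleton _))] at key2
    have h1 : {ω : ℕ → A | ∀ i ≤ n, ω i = η i} =
        (Preorder.frestrictLe (π := fun _ : ℕ => A) n) ⁻¹' {fun i : Finset.Iic n => η i} := by
      ext ω
      simp [Preorder.frestrictLe, funext_iff]
    have h2 : {ω : ℕ → A | ∀ i ≤ n + 1, ω i = η i} =
        (fun ω => (Preorder.frestrictLe (π := fun _ : ℕ => A) n ω, ω (n + 1))) ⁻¹'
          ({fun i : Finset.Iic n => η i} ×ˢ {η (n + 1)}) := by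
      ext ω
      simp [Preorder.frestrictLe, funext_iff, Nat.le_succ_iff, or_imp, forall_and]
    rw [Finset.prod_range_succ, ← ih, h2, h1]
    refine key2.symm.trans ?_
    rw [smul_eq_mul]
    congr 1
    exact PMF.toMeasure_apply_singleton _ _ (measurableSet_singleton _)


/-- `δ_j(f)` for `f : A^{n+1} → ℝ`: the supremum of `|f(ω) - f(ω')|` over `ω, ω'` that differ
at most in the coordinate `j`. -/
noncomputable def coordOsc {A : Type*} {n : ℕ} (f : (Fin (n + 1) → A) → ℝ) (j : Fin (n + 1)) :
    ℝ≥0∞ :=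
  ⨆ (ω : Fin (n + 1) → A) (a : A) (b : A),
    ENNReal.ofReal |f (Function.update ω j a) - f (Function.update ω j b)|

/-- The class `𝓛_n` of functions `f : A^{n+1} → ℝ` with `δ_j(f) < ∞` for `j = 0, …, n`. -/
def localFun (A : Type*) (n : ℕ) : Set ((Fin (n + 1) → A) → ℝ) :=
  {f | ∀ j, coordOsc f j < ∞}

/-- `‖δ(f)‖₂² = ∑_{j=0}^n δ_j(f)²`, for `f ∈ 𝓛_n`. -/
noncomputable def sqNormOsc {A : Type*} {n : ℕ} (f : (Fin (n + 1) → A) → ℝ) : ℝ :=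
  ∑ j, (coordOsc f j).toReal ^ 2

/-- `f : A^{n+1} → ℝ` as a function `ω ↦ f(ω_0, …, ω_n)` on `A^ℕ`. -/
def onSeq {A : Type*} {n : ℕ} (f : (Fin (n + 1) → A) → ℝ) (ω : ℕ → A) : ℝ :=
  f fun i => ω i

end SCUM

namespace SCUM

variable {A : Type*} [Countable A] [MeasurableSpace A] [DiscreteMeasurableSpace A]

/-! ### Renewal inequality for oscillation vectors in `ℓ²` -/

section Sequences

/-! Integrate out the symbols of the chain one at a time, from the last backwards. Given the earlier
symbols, Hoeffding's lemma bounds the exponential moment of the last one by the squared oscillation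
in that coordinate (`avg_exp_le`). What remains is a function of one symbol fewer; changing its
coordinate `i` changes both the integrand and, in total variation, the law integrated against, so
its oscillation grows by at most `Osc_{m-i} δ_m` (`OscLE.avg`).

Iterating, the oscillation `d_k` met when coordinate `k` is removed is controlled by `d = δ + O d`,
with `O` strictly upper triangular Toeplitz with entries `Osc_{l-k}`. Its row and column sums are at
most `1 - Δ(g)`, so `‖d‖₂ ≤ Δ(g)⁻¹ ‖δ‖₂` (`sum_sq_renewal_le`). The product of the Hoeffding factors
(`integral_exp_prefixLaw_le`) is then the exponential bound, uniformly in the past, and the tail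
bound follows by Chernoff on both sides. -/

theorem Ioo_succ_right_self (k : ℕ) : Finset.Ioo k (k + 1) = ∅ := by
  ext l; simp only [Finset.mem_Ioo, Finset.notMem_empty, iff_false]; omega

theorem Ioo_succ_right_eq_insert {k m : ℕ} (h : k < m) :
    Finset.Ioo k (m + 1) = insert m (Finset.Ioo k m) := by
  ext l; simp only [Finset.mem_Ioo, Finset.mem_insert]; omega

/-- The solution of `d = δ + O d` for a strictly upper triangular Toeplitz matrix `O`. -/
theorem exists_renewal_solution (o : ℕ → ℝ) (m : ℕ) (δ : ℕ → ℝ) : ∃ d : ℕ → ℝ,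
    ∀ k < m, d k = δ k + ∑ l ∈ Finset.Ioo k m, o (l - k - 1) * d l := by
  induction m generalizing δ with
  | zero => exact ⟨δ, by simp⟩
  | succ m ih =>
    -- Back substitution: the last unknown equals `δ m`, and its contribution is moved into the
    -- source term.
    obtain ⟨d, hd⟩ := ih (fun k => δ k + o (m - k - 1) * δ m)
    refine ⟨Function.update d m (δ m), fun k hk => ?_⟩
    rcases eq_or_ne k m with rfl | h
    · simp [Ioo_succ_right_self]
    · have hkm : k < m := by omega
      rw [Ioo_succ_right_eq_insert hkm, Finset.sum_insert (by simp), Function.update_of_ne h,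
        Function.update_self, hd k hkm, add_assoc]
      congr 2
      refine Finset.sum_congr rfl fun l hl => ?_
      rw [Function.update_of_ne (Finset.mem_Ioo.1 hl).2.ne]

/-- A Schur test: row sums enter through Cauchy–Schwarz, column sums after exchanging the order of
summation, and the term in `d` is absorbed on the left. -/
theorem sum_sq_renewal_le (o : ℕ → ℝ) (ho : ∀ j, 0 ≤ o j) (D : ℝ) (hD : 0 < D)
    (hs : ∀ F : Finset ℕ, ∑ j ∈ F, o j ≤ 1 - D) (m : ℕ) (δ d : ℕ → ℝ)
    (hd : ∀ k < m, d k = δ k + ∑ l ∈ Finset.Ioo k m, o (l - k - 1) * d l) :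
    ∑ k ∈ Finset.range m, d k ^ 2 ≤ D⁻¹ ^ 2 * ∑ k ∈ Finset.range m, δ k ^ 2 := by
  have row : ∀ k, ∑ l ∈ Finset.Ioo k m, o (l - k - 1) ≤ 1 - D := fun k => by
    rw [← Finset.sum_image (g := fun l => l - k - 1) (f := o)]
    · exact hs _
    · intro a ha b hb hab
      simp only [Finset.coe_Ioo, Set.mem_Ioo] at ha hb hab
      omega
  have col : ∀ l, ∑ k ∈ Finset.range l, o (l - k - 1) ≤ 1 - D := fun l => by
    rw [← Finset.sum_image (g := fun k => l - k - 1) (f := o)]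
    · exact hs _
    · intro a ha b hb hab
      simp only [Finset.coe_range, Set.mem_Iio] at ha hb hab
      omega
  have pt : ∀ k < m, d k ^ 2 ≤ D⁻¹ * δ k ^ 2 + ∑ l ∈ Finset.Ioo k m, o (l - k - 1) * d l ^ 2 := by
    intro k hk
    set S := ∑ l ∈ Finset.Ioo k m, o (l - k - 1) * d l with hS
    set Q := ∑ l ∈ Finset.Ioo k m, o (l - k - 1) * d l ^ 2 with hQ
    have hQ0 : 0 ≤ Q := Finset.sum_nonneg fun l _ => mul_nonneg (ho _) (sq_nonneg _)
    have hSQ : S ^ 2 ≤ (1 - D) * Q :=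
      (Finset.sum_sq_le_sum_mul_sum_of_sq_le_mul (Finset.Ioo k m) (fun l _ => ho (l - k - 1))
        (fun l _ => mul_nonneg (ho (l - k - 1)) (sq_nonneg (d l)))
        (fun l _ => (by ring : _ = _).le)).trans
        (mul_le_mul_of_nonneg_right (row k) hQ0)
    rw [hd k hk, ← hS]
    clear_value S Q
    -- Write `δ k + S = D t + (1 - D) v` and use convexity of the square; when `D = 1` there is no
    -- `v`, but then `S = 0`.
    have e : D⁻¹ * δ k ^ 2 = D * (δ k / D) ^ 2 := by field_simp
    have e' : δ k = D * (δ k / D) := by field_simp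
    rw [e]
    conv_lhs => rw [e']
    generalize δ k / D = t
    by_cases hD1 : D = 1
    · subst hD1
      have : S ^ 2 ≤ 0 := by simpa using hSQ
      have hS0 : S = 0 := by nlinarith
      rw [hS0]; nlinarith
    · have h1D : 0 < 1 - D := lt_of_le_of_ne (by simpa using hs ∅) (by intro h; apply hD1; linarith)
      have hQ' : S ^ 2 / (1 - D) ≤ Q := by rw [div_le_iff₀ h1D]; linarith
      refine le_trans ?_ (add_le_add_right hQ' _)
      have : S ^ 2 / (1 - D) = (1 - D) * (S / (1 - D)) ^ 2 := by field_simp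
      have hSe : S = (1 - D) * (S / (1 - D)) := by field_simp
      rw [this]
      conv_lhs => rw [hSe]
      generalize S / (1 - D) = v
      nlinarith [mul_nonneg (mul_nonneg hD.le h1D.le) (sq_nonneg (t - v))]
  have swap : ∑ k ∈ Finset.range m, ∑ l ∈ Finset.Ioo k m, o (l - k - 1) * d l ^ 2 =
      ∑ l ∈ Finset.range m, (∑ k ∈ Finset.range l, o (l - k - 1)) * d l ^ 2 := by
    simp_rw [Finset.sum_mul]
    refine Finset.sum_comm' fun k l => ?_
    simp only [Finset.mem_range, Finset.mem_Ioo]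
    omega
  have tot : ∑ k ∈ Finset.range m, d k ^ 2 ≤
      D⁻¹ * ∑ k ∈ Finset.range m, δ k ^ 2 + (1 - D) * ∑ k ∈ Finset.range m, d k ^ 2 := by
    calc _ ≤ ∑ k ∈ Finset.range m,
          (D⁻¹ * δ k ^ 2 + ∑ l ∈ Finset.Ioo k m, o (l - k - 1) * d l ^ 2) :=
        Finset.sum_le_sum fun k hk => pt k (Finset.mem_range.1 hk)
      _ ≤ _ := by
        rw [Finset.sum_add_distrib, swap, Finset.mul_sum, Finset.mul_sum]
        gcongr with l hl
        exact col l
  have : D * ∑ k ∈ Finset.range m, d k ^ 2 ≤ D⁻¹ * ∑ k ∈ Finset.range m, δ k ^ 2 := by linarith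
  rw [sq, mul_assoc]
  rwa [← div_eq_inv_mul, le_div_iff₀' hD]

end Sequences

/-! ### Coordinate oscillations and total variation -/

section Oscillation

/-- The oscillation of `f : A^m → ℝ` in the coordinate `i` is at most `δ i`. -/
def OscLE {A : Type*} {m : ℕ} (f : (Fin m → A) → ℝ) (δ : ℕ → ℝ) : Prop :=
  ∀ (i : Fin m) (σ : Fin m → A) (a b : A),
    |f (Function.update σ i a) - f (Function.update σ i b)| ≤ δ i

theorem OscLE.abs_snoc_sub_le {A : Type*} {m : ℕ} {f : (Fin (m + 1) → A) → ℝ} {δ : ℕ → ℝ}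
    (hf : OscLE f δ) (σ : Fin m → A) (a b : A) :
    |f (Fin.snoc σ a) - f (Fin.snoc σ b)| ≤ δ m := by
  simpa [Fin.update_snoc_last] using hf (Fin.last m) (Fin.snoc σ a) a b

theorem OscLE.snoc_right {A : Type*} {m : ℕ} {f : (Fin (m + 1) → A) → ℝ} {δ : ℕ → ℝ}
    (hf : OscLE f δ) (c : A) : OscLE (fun σ : Fin m → A => f (Fin.snoc σ c)) δ := by
  intro i σ a b
  simpa [Fin.snoc_update] using hf i.castSucc (Fin.snoc σ c) a b

/-- Telescoping over the coordinates; this makes local functions bounded, hence integrable. -/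
theorem OscLE.abs_sub_le {A : Type*} {m : ℕ} {f : (Fin m → A) → ℝ} {δ : ℕ → ℝ}
    (hf : OscLE f δ) (σ σ' : Fin m → A) : |f σ - f σ'| ≤ ∑ k ∈ Finset.range m, δ k := by
  induction m with
  | zero => simp [Subsingleton.elim σ σ']
  | succ m ih =>
    rw [Finset.sum_range_succ]
    have h1 := ih (hf.snoc_right (σ (Fin.last m))) (Fin.init σ) (Fin.init σ')
    have h2 := hf.abs_snoc_sub_le (Fin.init σ') (σ (Fin.last m)) (σ' (Fin.last m))
    simp only [Fin.snoc_init_self] at h1 h2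
    exact (_root_.abs_sub_le _ _ _).trans (add_le_add h1 h2)

theorem integrable_of_abs_sub_le {α : Type*} [Countable α] [MeasurableSpace α]
    [DiscreteMeasurableSpace α] (μ : Measure α) [IsFiniteMeasure μ] {f : α → ℝ} {D : ℝ}
    (hf : ∀ a b, |f a - f b| ≤ D) : Integrable f μ := by
  rcases isEmpty_or_nonempty α with h | ⟨⟨c⟩⟩
  · exact Integrable.of_finite
  · refine Integrable.of_bound (Measurable.of_discrete).aestronglyMeasurable (D + |f c|)
      (.of_forall fun a => ?_)
    calc ‖f a‖ = |(f a - f c) + f c| := by simp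
      _ ≤ _ := (abs_add_le _ _).trans (add_le_add_left (hf a c) _)

theorem exists_abs_sub_le_half {α : Type*} [Nonempty α] {f : α → ℝ} {D : ℝ}
    (hf : ∀ a b, |f a - f b| ≤ D) : ∃ c, ∀ a, |f a - c| ≤ D / 2 := by
  obtain ⟨b⟩ := ‹Nonempty α›
  have hbd : BddBelow (Set.range f) :=
    ⟨f b - D, by rintro _ ⟨a, rfl⟩; linarith [abs_le.1 (hf a b)]⟩
  refine ⟨(⨅ a, f a) + D / 2, fun a => abs_le.2 ⟨?_, ?_⟩⟩
  · linarith [ciInf_le hbd a]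
  · have : Nonempty α := ⟨b⟩
    have : f a - D ≤ ⨅ a, f a := le_ciInf fun c => by linarith [abs_le.1 (hf a c)]
    linarith

/-- Expectations under `p` and `q` differ by at most their total variation distance times the
oscillation of the integrand. -/
theorem abs_integral_sub_integral_le (p q : PMF A) {φ : A → ℝ} {D : ℝ}
    (hφ : ∀ a b, |φ a - φ b| ≤ D) {t : ℝ≥0∞} (ht : t ≠ ∞)
    (hpq : (1 / 2) * ∑' a, ENNReal.ofReal |(p a).toReal - (q a).toReal| ≤ t) :
    |∫ a, φ a ∂p.toMeasure - ∫ a, φ a ∂q.toMeasure| ≤ t.toReal * D := by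
  have : Nonempty A := ⟨p.support_nonempty.some⟩
  have hD : 0 ≤ D := (abs_nonneg _).trans (hφ (Classical.arbitrary A) (Classical.arbitrary A))
  -- Centring at the midrange costs nothing, since `p` and `q` have equal mass, and gives the factor
  -- `D / 2` that matches the `1 / 2` in total variation.
  obtain ⟨c, hc⟩ := exists_abs_sub_le_half hφ
  have hint : ∀ r : PMF A, Integrable φ r.toMeasure := fun r => integrable_of_abs_sub_le _ hφ
  have hint' : ∀ r : PMF A, Integrable (fun a => φ a - c) r.toMeasure := fun r =>
    (hint r).sub (integrable_const c)
  have hshift : ∀ r : PMF A, ∫ a, φ a ∂r.toMeasure = ∑' a, (r a).toReal * (φ a - c) + c := by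
    intro r
    have := PMF.integral_eq_tsum r _ (hint' r)
    simp only [smul_eq_mul] at this
    rw [← this, integral_sub (hint r) (integrable_const c)]
    simp
  have hsr : ∀ r : PMF A, Summable fun a => (r a).toReal := fun r =>
    ENNReal.summable_toReal r.tsum_coe_ne_top
  have hsum : ∀ r : PMF A, Summable fun a => (r a).toReal * (φ a - c) := fun r => by
    refine Summable.of_norm_bounded ((hsr r).mul_right (D / 2)) fun a => ?_
    rw [norm_mul, Real.norm_eq_abs, Real.norm_eq_abs, abs_of_nonneg ENNReal.toReal_nonneg]
    exact mul_le_mul_of_nonneg_left (hc a) ENNReal.toReal_nonneg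
  have hsabs : Summable fun a => |(p a).toReal - (q a).toReal| := ((hsr p).sub (hsr q)).abs
  have htv : (∑' a, |(p a).toReal - (q a).toReal|) / 2 ≤ t.toReal := by
    rw [← ENNReal.ofReal_tsum_of_nonneg (fun _ => abs_nonneg _) hsabs] at hpq
    have := ENNReal.toReal_mono ht hpq
    rw [ENNReal.toReal_mul, ENNReal.toReal_ofReal (tsum_nonneg fun _ => abs_nonneg _)] at this
    simp at this
    linarith
  rw [hshift p, hshift q, add_sub_add_right_eq_sub, ← (hsum p).tsum_sub (hsum q)]
  have hterm : ∀ a, ‖(p a).toReal * (φ a - c) - (q a).toReal * (φ a - c)‖ ≤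
      |(p a).toReal - (q a).toReal| * (D / 2) := fun a => by
    rw [← sub_mul, norm_mul]
    exact mul_le_mul_of_nonneg_left (hc a) (abs_nonneg _)
  refine (tsum_of_norm_bounded (hsabs.mul_right (D / 2)).hasSum hterm).trans ?_
  rw [tsum_mul_right]
  nlinarith

end Oscillation

/-! ### Integrating out the last symbol -/

section Averaging

/-- The conditional expectation of `f : A^{m+1} → ℝ` given the first `m` symbols of the chain. -/
noncomputable def avg (g : ProbKernel A) (x : ℕ → A) {m : ℕ} (f : (Fin (m + 1) → A) → ℝ)
    (σ : Fin m → A) : ℝ :=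
  ∫ a, f (Fin.snoc σ a) ∂(g (concat x m σ)).toMeasure

theorem concat_update_of_ne {A : Type*} (x : ℕ → A) {m : ℕ} (σ : Fin m → A) (i : Fin m) (a b : A)
    (k : ℕ) (hk : k + 1 ≠ m - i) :
    concat x m (Function.update σ i a) k = concat x m (Function.update σ i b) k := by
  unfold concat
  split_ifs with h
  · have : (⟨m - 1 - k, by omega⟩ : Fin m) ≠ i := by
      intro e
      have := congrArg Fin.val e
      simp only at this
      omega
    rw [Function.update_of_ne this, Function.update_of_ne this]
  · rfl

/-- Integrating out the last coordinate propagates oscillations through the kernel. -/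
theorem OscLE.avg {g : ProbKernel A} (x : ℕ → A) (hg : ∀ j, osc g (j + 1) ≠ ∞) {m : ℕ}
    {f : (Fin (m + 1) → A) → ℝ} {δ : ℕ → ℝ} (hf : OscLE f δ) :
    OscLE (avg g x f) fun i => δ i + (osc g (m - i - 1 + 1)).toReal * δ m := by
  intro i σ a b
  set p := g (concat x m (Function.update σ i a)) with hp
  set q := g (concat x m (Function.update σ i b)) with hq
  have hm : m - i - 1 + 1 = m - i := by omega
  have hv := hf.abs_snoc_sub_le (Function.update σ i b)
  have hu := hf.abs_snoc_sub_le (Function.update σ i a)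
  have htv := abs_integral_sub_integral_le p q hv (hg (m - i - 1)) <| by
    rw [hm]
    unfold osc
    exact le_iSup_of_le _ (le_iSup_of_le _ (le_iSup_of_le
      (fun k hk => concat_update_of_ne x σ i a b k hk) le_rfl))
  have hiu := integrable_of_abs_sub_le p.toMeasure hu
  have hiv := integrable_of_abs_sub_le p.toMeasure hv
  have hdiff : |∫ c, f (Fin.snoc (Function.update σ i a) c) ∂p.toMeasure -
      ∫ c, f (Fin.snoc (Function.update σ i b) c) ∂p.toMeasure| ≤ δ i := by
    rw [← integral_sub hiu hiv, ← Real.norm_eq_abs]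
    refine (norm_integral_le_of_norm_le_const (C := δ i) (.of_forall fun c => ?_)).trans_eq
      (by simp)
    exact hf.snoc_right c i σ a b
  -- The intermediate term has the new integrand (`b`) and the old law `p`.
  exact (_root_.abs_sub_le _ _ _).trans (add_le_add hdiff htv)

/-- Hoeffding's lemma for the last symbol. -/
theorem avg_exp_le {A : Type*} [MeasurableSpace A] [DiscreteMeasurableSpace A]
    (g : ProbKernel A) (x : ℕ → A) {m : ℕ} {f : (Fin (m + 1) → A) → ℝ} {D : ℝ}
    (hf : ∀ (σ : Fin m → A) a b, |f (Fin.snoc σ a) - f (Fin.snoc σ b)| ≤ D) (θ : ℝ)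
    (σ : Fin m → A) :
    avg g x (fun τ => Real.exp (θ * f τ)) σ ≤
      Real.exp (θ * avg g x f σ) * Real.exp (θ ^ 2 / 8 * D ^ 2) := by
  set μ := (g (concat x m σ)).toMeasure with hμ
  have : Nonempty A := ⟨(g (concat x m σ)).support_nonempty.some⟩
  obtain ⟨c, hc⟩ := exists_abs_sub_le_half (hf σ)
  have h := (hasSubgaussianMGF_of_mem_Icc (μ := μ) (X := fun a => f (Fin.snoc σ a))
    (a := c - D / 2) (b := c + D / 2) (Measurable.of_discrete).aemeasurable
    (.of_forall fun a => ⟨by linarith [abs_le.1 (hc a)], by linarith [abs_le.1 (hc a)]⟩)).mgf_le θ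
  have e : (((‖c + D / 2 - (c - D / 2)‖₊ / 2) ^ 2 : NNReal) : ℝ) * θ ^ 2 / 2 =
      θ ^ 2 / 8 * D ^ 2 := by
    have : c + D / 2 - (c - D / 2) = D := by ring
    rw [this]
    push_cast
    rw [div_pow, Real.norm_eq_abs, sq_abs]
    ring
  rw [e] at h
  have : avg g x (fun τ => Real.exp (θ * f τ)) σ = Real.exp (θ * avg g x f σ) *
      mgf (fun a => f (Fin.snoc σ a) - ∫ a, f (Fin.snoc σ a) ∂μ) μ θ := by
    unfold mgf
    rw [← integral_const_mul]
    refine integral_congr_ae (.of_forall fun a => ?_)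
    simp only
    rw [← Real.exp_add]
    congr 1
    unfold SCUM.avg
    ring
  rw [this]
  exact mul_le_mul_of_nonneg_left h (Real.exp_pos _).le

end Averaging

/-! ### Induction along the chain -/

section Chain

/-- The law of the first `m` symbols of the chain. -/
noncomputable def prefixLaw (g : ProbKernel A) (x : ℕ → A) (m : ℕ) : Measure (Fin m → A) :=
  (chainMeasure g x).map fun ω i => ω i

theorem measurable_prefix {A : Type*} [MeasurableSpace A] (m : ℕ) :
    Measurable fun (ω : ℕ → A) (i : Fin m) => ω i := by
  fun_prop

instance (g : ProbKernel A) (x : ℕ → A) (m : ℕ) : IsProbabilityMeasure (prefixLaw g x m) :=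
  Measure.isProbabilityMeasure_map (measurable_prefix m).aemeasurable

theorem prefixLaw_singleton (g : ProbKernel A) (x : ℕ → A) (m : ℕ) (η : ℕ → A) :
    prefixLaw g x m {fun i : Fin m => η i} =
      ∏ j ∈ Finset.range m, g (concat x j fun i => η i) (η j) := by
  rw [prefixLaw, Measure.map_apply (measurable_prefix m) (measurableSet_singleton _)]
  have : (fun (ω : ℕ → A) (i : Fin m) => ω i) ⁻¹' {fun i : Fin m => η i} =
      {ω | ∀ i < m, ω i = η i} := by
    ext ω
    simp [funext_iff, Fin.forall_iff]
  rw [this]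
  cases m with
  | zero => simp
  | succ m => simpa [Nat.lt_succ_iff] using chainMeasure_cylinder g x η m

/-- The law of the next symbol given the first `m` symbols. -/
noncomputable def nextKernel (g : ProbKernel A) (x : ℕ → A) (m : ℕ) : Kernel (Fin m → A) A :=
  Kernel.ofFunOfCountable fun σ => (g (concat x m σ)).toMeasure

instance (g : ProbKernel A) (x : ℕ → A) (m : ℕ) : IsMarkovKernel (nextKernel g x m) :=
  ⟨fun _ => inferInstanceAs (IsProbabilityMeasure (PMF.toMeasure _))⟩

theorem prefixLaw_succ (g : ProbKernel A) (x : ℕ → A) (m : ℕ) :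
    prefixLaw g x (m + 1) =
      (prefixLaw g x m ⊗ₘ nextKernel g x m).map fun z => (Fin.snoc z.1 z.2 : Fin (m + 1) → A) := by
  refine Measure.ext_of_singleton fun τ => ?_
  -- The cylinder formula takes infinite sequences; the padding value `x 0` is immaterial.
  set η : ℕ → A := fun k => if h : k < m + 1 then τ ⟨k, h⟩ else x 0 with hη
  have hτ : τ = fun i : Fin (m + 1) => η i := by
    ext i
    simp only [hη, dif_pos i.2]
  rw [Measure.map_apply Measurable.of_discrete (measurableSet_singleton _)]
  have hpre : (fun z : (Fin m → A) × A => (Fin.snoc z.1 z.2 : Fin (m + 1) → A)) ⁻¹' {τ} =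
      {fun i : Fin m => η i} ×ˢ {η m} := by
    ext ⟨σ, a⟩
    simp only [Set.mem_preimage, Set.mem_singleton_iff, Set.mem_prod]
    rw [hτ]
    constructor
    · intro h
      refine ⟨funext fun i => ?_, ?_⟩
      · simpa using congrFun h i.castSucc
      · simpa using congrFun h (Fin.last m)
    · rintro ⟨h1, h2⟩
      ext i
      refine Fin.lastCases ?_ (fun i => ?_) i
      · simpa using h2
      · simpa using congrFun h1 i
  rw [hpre, Measure.compProd_apply_prod (measurableSet_singleton _) (measurableSet_singleton _),
    Measure.restrict_singleton, lintegral_smul_measure, lintegral_dirac, hτ, prefixLaw_singleton,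
    Finset.prod_range_succ, prefixLaw_singleton, smul_eq_mul]
  congr 1
  exact (PMF.toMeasure_apply_singleton _ _ (measurableSet_singleton _)).symm

theorem integral_prefixLaw_succ (g : ProbKernel A) (x : ℕ → A) {m : ℕ}
    {f : (Fin (m + 1) → A) → ℝ} (hf : Integrable f (prefixLaw g x (m + 1))) :
    ∫ τ, f τ ∂(prefixLaw g x (m + 1)) = ∫ σ, avg g x f σ ∂(prefixLaw g x m) := by
  rw [prefixLaw_succ] at hf ⊢
  have hm : Measurable fun z : (Fin m → A) × A => (Fin.snoc z.1 z.2 : Fin (m + 1) → A) :=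
    Measurable.of_discrete
  rw [integral_map hm.aemeasurable (Measurable.of_discrete).aestronglyMeasurable,
    Measure.integral_compProd
      (f := fun z : (Fin m → A) × A => f (Fin.snoc z.1 z.2)) (hf.comp_measurable hm)]
  rfl

theorem OscLE.integrable {m : ℕ} {f : (Fin m → A) → ℝ} {δ : ℕ → ℝ} (hf : OscLE f δ)
    (μ : Measure (Fin m → A)) [IsFiniteMeasure μ] : Integrable f μ :=
  integrable_of_abs_sub_le μ hf.abs_sub_le

theorem OscLE.integrable_exp {m : ℕ} {f : (Fin m → A) → ℝ} {δ : ℕ → ℝ} (hf : OscLE f δ)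
    (μ : Measure (Fin m → A)) [IsFiniteMeasure μ] (θ : ℝ) :
    Integrable (fun σ => Real.exp (θ * f σ)) μ := by
  rcases isEmpty_or_nonempty (Fin m → A) with h | ⟨⟨c⟩⟩
  · exact Integrable.of_finite
  · refine Integrable.of_bound (Measurable.of_discrete).aestronglyMeasurable
      (Real.exp (|θ| * (∑ k ∈ Finset.range m, δ k + |f c|))) (.of_forall fun a => ?_)
    rw [Real.norm_eq_abs, Real.abs_exp]
    refine Real.exp_le_exp.2 ((le_abs_self _).trans ?_)
    rw [abs_mul]
    refine mul_le_mul_of_nonneg_left ?_ (abs_nonneg _)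
    calc |f a| = |(f a - f c) + f c| := by simp
      _ ≤ _ := (abs_add_le _ _).trans (add_le_add_left (hf.abs_sub_le a c) _)

theorem integral_exp_prefixLaw_le {g : ProbKernel A} (x : ℕ → A) (hg : ∀ j, osc g (j + 1) ≠ ∞)
    (d : ℕ → ℝ) (θ : ℝ) {m : ℕ} {f : (Fin m → A) → ℝ} {δ : ℕ → ℝ} (hf : OscLE f δ)
    (hd : ∀ k < m,
      δ k + ∑ l ∈ Finset.Ioo k m, (osc g (l - k - 1 + 1)).toReal * d l ≤ d k) :
    ∫ σ, Real.exp (θ * f σ) ∂(prefixLaw g x m) ≤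
      Real.exp (θ * ∫ σ, f σ ∂(prefixLaw g x m) + θ ^ 2 / 8 * ∑ k ∈ Finset.range m, d k ^ 2) := by
  induction m generalizing δ with
  | zero =>
    have : ∀ σ, f σ = f Fin.elim0 := fun σ => congrArg f (Subsingleton.elim _ _)
    simp [this]
  | succ m ih =>
    have hdm : δ m ≤ d m := by
      simpa [Ioo_succ_right_self] using hd m (Nat.lt_succ_self m)
    -- `d` stays fixed while `δ` is updated: as `δ m ≤ d m`, the increment of `δ k` is covered by
    -- the `l = m` term of the sum.
    have hIH := ih (hf.avg x hg) fun k hk => by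
      refine le_trans ?_ (hd k (hk.trans (Nat.lt_succ_self m)))
      rw [Ioo_succ_right_eq_insert hk, Finset.sum_insert (by simp), ← add_assoc]
      gcongr
    rw [integral_prefixLaw_succ g x (hf.integrable_exp _ θ),
      integral_prefixLaw_succ g x (hf.integrable _), Finset.sum_range_succ, mul_add, ← add_assoc,
      Real.exp_add]
    calc _ ≤ ∫ σ, Real.exp (θ * avg g x f σ) * Real.exp (θ ^ 2 / 8 * d m ^ 2)
          ∂(prefixLaw g x m) := by
          refine integral_mono_of_nonneg
            (.of_forall fun σ => integral_nonneg fun a => (Real.exp_pos _).le)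
            (((hf.avg x hg).integrable_exp _ θ).mul_const _) (.of_forall fun σ => ?_)
          exact avg_exp_le g x (fun σ a b => (hf.abs_snoc_sub_le σ a b).trans hdm) θ σ
      _ ≤ _ := by
          rw [integral_mul_const]
          exact mul_le_mul_of_nonneg_right hIH (Real.exp_pos _).le

end Chain

/-! ### Sub-Gaussian bound and the theorem -/

section Concentration

theorem oscLE_coordOsc {A : Type*} {n : ℕ} {f : (Fin (n + 1) → A) → ℝ} (hf : f ∈ localFun A n) :
    OscLE f fun k => if h : k < n + 1 then (coordOsc f ⟨k, h⟩).toReal else 0 := by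
  intro i σ a b
  simp only [i.2, dif_pos]
  rw [← ENNReal.toReal_ofReal (abs_nonneg (f (Function.update σ i a) - f (Function.update σ i b)))]
  refine ENNReal.toReal_mono (hf i).ne ?_
  exact le_iSup_of_le σ (le_iSup_of_le a (le_iSup_of_le b le_rfl))

theorem sqNormOsc_eq_sum_range {A : Type*} {n : ℕ} (f : (Fin (n + 1) → A) → ℝ) :
    sqNormOsc f = ∑ k ∈ Finset.range (n + 1),
      (if h : k < n + 1 then (coordOsc f ⟨k, h⟩).toReal else 0) ^ 2 := by
  rw [Finset.sum_range, sqNormOsc]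
  exact Finset.sum_congr rfl fun i _ => by rw [dif_pos i.2]

theorem tsum_osc_of_delta_pos {A : Type*} {g : ProbKernel A} (hg : 0 < delta g) :
    (∑' j : ℕ, osc g (j + 1)) ≠ ∞ ∧
      (delta g).toReal = 1 - (∑' j : ℕ, osc g (j + 1)).toReal ∧ 0 < (delta g).toReal := by
  unfold delta at hg ⊢
  generalize (∑' j : ℕ, osc g (j + 1)) = S at hg ⊢
  induction S with
  | top => simp at hg
  | coe S =>
    have e : (1 : EReal) - (((S : ℝ≥0∞)) : EReal) = ((1 - (S : ℝ) : ℝ) : EReal) := by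
      rw [EReal.coe_sub]; rfl
    rw [e] at hg ⊢
    exact ⟨ENNReal.coe_ne_top, rfl, EReal.coe_pos.1 hg⟩

/-- Sub-Gaussian concentration of local functions of the chain. -/
theorem hasSubgaussianMGF_onSeq (g : ProbKernel A) (hg : 0 < delta g) {n : ℕ}
    {f : (Fin (n + 1) → A) → ℝ} (hf : f ∈ localFun A n) (x : ℕ → A) :
    HasSubgaussianMGF (fun ω => onSeq f ω - ∫ ω', onSeq f ω' ∂(chainMeasure g x))
      (((delta g).toReal)⁻¹ ^ 2 / 4 * sqNormOsc f).toNNReal (chainMeasure g x) := by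
  obtain ⟨hS, hD, hD0⟩ := tsum_osc_of_delta_pos hg
  have hfin : ∀ j, osc g (j + 1) ≠ ∞ := fun j => ENNReal.ne_top_of_tsum_ne_top hS j
  have hosc := oscLE_coordOsc hf
  have hsq := sqNormOsc_eq_sum_range f
  set δ : ℕ → ℝ := fun k => if h : k < n + 1 then (coordOsc f ⟨k, h⟩).toReal else 0
  have ho : ∀ j, 0 ≤ (osc g (j + 1)).toReal := fun j => ENNReal.toReal_nonneg
  obtain ⟨d, hd⟩ := exists_renewal_solution (fun j => (osc g (j + 1)).toReal) (n + 1) δ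
  have hle := sum_sq_renewal_le _ ho _ hD0 (fun F => by
    rw [hD, sub_sub_cancel, ← ENNReal.toReal_sum fun j _ => hfin j]
    exact ENNReal.toReal_mono hS (ENNReal.sum_le_tsum F)) (n + 1) δ d hd
  rw [← hsq] at hle
  have hm := measurable_prefix (A := A) (n + 1)
  have hmean : ∫ ω, onSeq f ω ∂(chainMeasure g x) = ∫ σ, f σ ∂(prefixLaw g x (n + 1)) :=
    (integral_map hm.aemeasurable (Measurable.of_discrete).aestronglyMeasurable).symm
  have h0 : 0 ≤ ((delta g).toReal)⁻¹ ^ 2 / 4 * sqNormOsc f :=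
    mul_nonneg (by positivity) (Finset.sum_nonneg fun i _ => sq_nonneg _)
  rw [hmean]
  set c := ∫ σ, f σ ∂(prefixLaw g x (n + 1)) with hc
  suffices h : HasSubgaussianMGF (fun σ => f σ - c)
      (((delta g).toReal)⁻¹ ^ 2 / 4 * sqNormOsc f).toNNReal (prefixLaw g x (n + 1)) from
    HasSubgaussianMGF.of_map hm.aemeasurable h
  have hexp : ∀ t : ℝ, (fun σ => Real.exp (t * (f σ - c))) =
      fun σ => Real.exp (t * f σ) * Real.exp (-(t * c)) := fun t => by
    ext σ
    rw [← Real.exp_add]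
    ring_nf
  refine ⟨fun t => ?_, fun t => ?_⟩
  · rw [hexp t]
    exact (hosc.integrable_exp _ t).mul_const _
  · unfold mgf
    rw [hexp t, integral_mul_const]
    refine (mul_le_mul_of_nonneg_right (integral_exp_prefixLaw_le x hfin d t hosc
      fun k hk => (hd k hk).ge) (Real.exp_pos _).le).trans ?_
    rw [← Real.exp_add, Real.coe_toNNReal _ h0]
    refine Real.exp_le_exp.2 ?_
    have := mul_le_mul_of_nonneg_left hle (by positivity : 0 ≤ t ^ 2 / 8)
    linarith

end Concentration

end SCUM

theorem mainTheorem1 {A : Type*} [Countable A] [MeasurableSpace A] [DiscreteMeasurableSpace A]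
    (g : SCUM.ProbKernel A) (hg : 0 < SCUM.delta g)
    (n : ℕ) (f : (Fin (n + 1) → A) → ℝ) (hf : f ∈ SCUM.localFun A n) :
    (∀ x : ℕ → A, Integrable (SCUM.onSeq f) (SCUM.chainMeasure g x)) ∧
    (∀ θ : ℝ,
      (⨆ x : ℕ → A, ∫⁻ ω, ENNReal.ofReal (Real.exp
          (θ * (SCUM.onSeq f ω - ∫ ω', SCUM.onSeq f ω' ∂(SCUM.chainMeasure g x))))
          ∂(SCUM.chainMeasure g x)) ≤
        ENNReal.ofReal (Real.exp
          (θ ^ 2 * ((SCUM.delta g).toReal)⁻¹ ^ 2 / 8 * SCUM.sqNormOsc f))) ∧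
    (∀ u : ℝ, 0 < u →
      (⨆ x : ℕ → A, SCUM.chainMeasure g x
          {ω | u < |SCUM.onSeq f ω - ∫ ω', SCUM.onSeq f ω' ∂(SCUM.chainMeasure g x)|}) ≤
        if SCUM.sqNormOsc f = 0 then 0 else
          ENNReal.ofReal (2 * Real.exp
            (-(2 * u ^ 2 / (((SCUM.delta g).toReal)⁻¹ ^ 2 * SCUM.sqNormOsc f))))) := by
  have hsub := SCUM.hasSubgaussianMGF_onSeq g hg hf
  have h0 : 0 ≤ ((SCUM.delta g).toReal)⁻¹ ^ 2 / 4 * SCUM.sqNormOsc f :=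
    mul_nonneg (by positivity) (Finset.sum_nonneg fun i _ => sq_nonneg _)
  refine ⟨fun x => ?_, fun θ => iSup_le fun x => ?_, fun u hu => iSup_le fun x => ?_⟩
  · exact ((SCUM.oscLE_coordOsc hf).integrable (SCUM.prefixLaw g x (n + 1))).comp_measurable
      (SCUM.measurable_prefix (n + 1))
  · rw [← ofReal_integral_eq_lintegral_ofReal ((hsub x).integrable_exp_mul θ)
      (.of_forall fun _ => (Real.exp_pos _).le)]
    refine ENNReal.ofReal_le_ofReal (((hsub x).mgf_le θ).trans_eq ?_)
    rw [Real.coe_toNNReal _ h0]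
    congr 1
    ring
  · have hx := hsub x
    set X : (ℕ → A) → ℝ :=
      fun ω => SCUM.onSeq f ω - ∫ ω', SCUM.onSeq f ω' ∂(SCUM.chainMeasure g x) with hX
    change SCUM.chainMeasure g x {ω | u < |X ω|} ≤ _
    split_ifs with hz
    -- Chernoff's bound degenerates here, but variance proxy zero forces `X = 0` almost everywhere.
    · rw [hz, mul_zero, Real.toNNReal_zero] at hx
      have hae : X =ᵐ[SCUM.chainMeasure g x] 0 := hx.ae_eq_zero_of_hasSubgaussianMGF_zero
      refine (measure_mono_null (fun ω hω => ?_) hae).le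
      intro h
      have h' : X ω = 0 := h
      have hω' : u < |X ω| := hω
      rw [h', abs_zero] at hω'
      linarith
    · have hpos := hx.measure_ge_le hu.le
      have hneg := hx.neg.measure_ge_le hu.le
      have hsubset : {ω | u < |X ω|} ⊆ {ω | u ≤ X ω} ∪ {ω | u ≤ (-X) ω} := fun ω hω => by
        rcases lt_abs.1 (show u < |X ω| from hω) with h | h
        · exact Or.inl h.le
        · exact Or.inr h.le
      have e : -u ^ 2 / (2 * (((SCUM.delta g).toReal⁻¹ ^ 2 / 4 * SCUM.sqNormOsc f).toNNReal : ℝ)) =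
          -(2 * u ^ 2 / (((SCUM.delta g).toReal)⁻¹ ^ 2 * SCUM.sqNormOsc f)) := by
        rw [Real.coe_toNNReal _ h0]
        have := (SCUM.tsum_osc_of_delta_pos hg).2.2
        field_simp
        ring
      rw [e] at hpos hneg
      rw [← ofReal_measureReal]
      refine ENNReal.ofReal_le_ofReal ((measureReal_mono hsubset).trans
        ((measureReal_union_le _ _).trans ?_))
      linarith
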